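/- **Definitions.** A weight is a measurable function $w:\mathbb R\to[0,\infty)$. For $\beta\in\{1,2,4\}$ let $\mathrm{OE}_n(w)$ ($\beta=1$), $\mathrm{UE}_n(w)$ ($\beta=2$), $\mathrm{SE}_n(w)$ ($\beta=4$) be the probability law of $n$ real eigenvalues with density $$\frac1Z\prod_{i=0}^{n-1}w(x_i)\prod_{0\le i<j\le n-1}|x_j-x_i|^\beta ;$$ the ensemble is defined when the normalization $Z$ satisfies $0<Z<\infty$. The union $M\cup M'$ of two ensembles is the superposition of two independent spectra. $\mathrm{even}(M)$ is the random point configuration formed by the 2nd largest, 4th largest, … eigenvalues of $M$, and $\mathrm{odd}(M)$ the one formed by the largest, 3rd largest, … eigenvalues; for an even number of eigenvalues, $\mathrm{alt}(M)$ is $\mathrm{even}(M)$ or $\mathrm{odd}(M)$ with probability $1/2$ each. An equality between ensembles means equality of the laws of the unordered point configurations. $E^{(\beta)}(p;J;w;n)$ denotes the probability that exactly $p$ of the $n$ eigenvalues of the ensemble ($\mathrm{OE}_n(w)$, $\mathrm{UE}_n(w)$, $\mathrm{SE}_n(w)$ for $\beta=1,2,4$) lie in $J$; it is $0$ for $p<0$.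 **Theorem.** Let $n\ge1$, let $f,g$ be weights, and read $(g/f)^2$ as $0$ where $f=0$. In each item below, (a) and (b) are separate implications, the orthogonal ensembles in the hypothesis are supposed to be defined, and the conclusions hold for all $s\in\mathbb R$ and all $p\in\mathbb Z$. In items 1, 4 and 5, $J$ is either of the half-lines $(-\infty,-s)$, $(s,\infty)$. 1. (a) If $\mathrm{even}(\mathrm{OE}_{2n}(f)\cup\mathrm{OE}_{2n+1}(f))=\mathrm{UE}_{2n}(g)$, then $$E^{(2)}(0;J;g;2n)=E^{(1)}(0;J;f;2n)E^{(1)}(0;J;f;2n+1)+E^{(1)}(0;J;f;2n)E^{(1)}(1;J;f;2n+1)+E^{(1)}(0;J;f;2n+1)E^{(1)}(1;J;f;2n).$$ (b) If $\mathrm{even}(\mathrm{OE}_{2n+1}(f))=\mathrm{SE}_n((g/f)^2)$, then $$E^{(4)}(p;J;(g/f)^2;n)=E^{(1)}(2p;J;f;2n+1)+E^{(1)}(2p+1;J;f;2n+1).$$ 2. (a) If $\mathrm{even}(\mathrm{OE}_{2n}(f)\cup\mathrm{OE}_{2n}(f))=\mathrm{UE}_{2n}(g)$, then $$E^{(2)}(0;(s,\infty);g;2n)=\big(E^{(1)}(0;(s,\infty);f;2n)\big)^2+2E^{(1)}(0;(s,\infty);f;2n)E^{(1)}(1;(s,\infty);f;2n),$$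 $$E^{(2)}(0;(-\infty,-s);g;2n)=\big(E^{(1)}(0;(-\infty,-s);f;2n)\big)^2.$$ (b) If $\mathrm{even}(\mathrm{OE}_{2n}(f))=\mathrm{SE}_n((g/f)^2)$, then $$E^{(4)}(p;(s,\infty);(g/f)^2;n)=E^{(1)}(2p;(s,\infty);f;2n)+E^{(1)}(2p+1;(s,\infty);f;2n),$$ $$E^{(4)}(p;(-\infty,-s);(g/f)^2;n)=E^{(1)}(2p;(-\infty,-s);f;2n)+E^{(1)}(2p-1;(-\infty,-s);f;2n).$$ 3. (a) If $\mathrm{odd}(\mathrm{OE}_{2n}(f)\cup\mathrm{OE}_{2n}(f))=\mathrm{UE}_{2n}(g)$, then $$E^{(2)}(0;(s,\infty);g;2n)=\big(E^{(1)}(0;(s,\infty);f;2n)\big)^2,$$ $$E^{(2)}(0;(-\infty,-s);g;2n)=\big(E^{(1)}(0;(-\infty,-s);f;2n)\big)^2+2E^{(1)}(0;(-\infty,-s);f;2n)E^{(1)}(1;(-\infty,-s);f;2n).$$ (b) If $\mathrm{odd}(\mathrm{OE}_{2n}(f))=\mathrm{SE}_n((g/f)^2)$, then $$E^{(4)}(p;(s,\infty);(g/f)^2;n)=E^{(1)}(2p;(s,\infty);f;2n)+E^{(1)}(2p-1;(s,\infty);f;2n),$$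 $$E^{(4)}(p;(-\infty,-s);(g/f)^2;n)=E^{(1)}(2p;(-\infty,-s);f;2n)+E^{(1)}(2p+1;(-\infty,-s);f;2n).$$ 4. (a) If $\mathrm{odd}(\mathrm{OE}_{2n-1}(f)\cup\mathrm{OE}_{2n}(f))=\mathrm{UE}_{2n}(g)$, then $$E^{(2)}(0;J;g;2n)=E^{(1)}(0;J;f;2n)E^{(1)}(0;J;f;2n-1).$$ (b) If $\mathrm{odd}(\mathrm{OE}_{2n-1}(f))=\mathrm{SE}_n((g/f)^2)$, then $$E^{(4)}(p;J;(g/f)^2;n)=E^{(1)}(2p;J;f;2n-1)+E^{(1)}(2p-1;J;f;2n-1).$$ 5. (a) If $\mathrm{alt}(\mathrm{OE}_{2n}(f)\cup\mathrm{OE}_{2n}(f))=\mathrm{UE}_{2n}(g)$, then $$E^{(2)}(0;J;g;2n)=E^{(1)}(0;J;f;2n)\big(E^{(1)}(0;J;f;2n)+E^{(1)}(1;J;f;2n)\big).$$ (b) If $\mathrm{alt}(\mathrm{OE}_{2n}(f))=\mathrm{SE}_n((g/f)^2)$, then $$E^{(4)}(p;J;(g/f)^2;n)=E^{(1)}(2p;J;f;2n)+\tfrac12E^{(1)}(2p-1;J;f;2n)+\tfrac12E^{(1)}(2p+1;J;f;2n).$$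 -/

import Mathlib

open MeasureTheory
open scoped ENNReal

namespace EigenvalueEnsemble

noncomputable section

/-- The unnormalized eigenvalue density `∏ w(x_i) · ∏_{i<j} |x_j - x_i|^β` of `n` eigenvalues. -/
def density (β : ℕ) (w : ℝ → ℝ) (n : ℕ) (x : Fin n → ℝ) : ℝ :=
  (∏ i, w (x i)) * ∏ i, ∏ j ∈ Finset.Ioi i, |x j - x i| ^ β

/-- The normalization constant: the total integral of the density over `ℝⁿ`. -/
def partitionFn (β : ℕ) (w : ℝ → ℝ) (n : ℕ) : ℝ≥0∞ :=
  ∫⁻ x : Fin n → ℝ, ENNReal.ofReal (density β w n x)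

/-- The density can be normalized to a probability density, so that the ensemble exists. -/
def IsNormalizable (β : ℕ) (w : ℝ → ℝ) (n : ℕ) : Prop :=
  0 < partitionFn β w n ∧ partitionFn β w n < ∞

/-- The law on `ℝⁿ` with probability density proportional to `density β w n`. -/
def ensemble (β : ℕ) (w : ℝ → ℝ) (n : ℕ) : Measure (Fin n → ℝ) :=
  (partitionFn β w n)⁻¹ •
    (volume : Measure (Fin n → ℝ)).withDensity (fun x => ENNReal.ofReal (density β w n x))

/-- The orthogonal ensemble `OE_n(w)`. -/
abbrev OE (n : ℕ) (w : ℝ → ℝ) : Measure (Fin n → ℝ) := ensemble 1 w n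

/-- The unitary ensemble `UE_n(w)`. -/
abbrev UE (n : ℕ) (w : ℝ → ℝ) : Measure (Fin n → ℝ) := ensemble 2 w n

/-- The symplectic ensemble `SE_n(w)`. -/
abbrev SE (n : ℕ) (w : ℝ → ℝ) : Measure (Fin n → ℝ) := ensemble 4 w n

/-- The random union of two ensembles: two independent spectra are superimposed. -/
def union {m n : ℕ} (M : Measure (Fin m → ℝ)) (M' : Measure (Fin n → ℝ)) :
    Measure (Fin (m + n) → ℝ) :=
  (M.prod M').map (fun q => Fin.append q.1 q.2)

/-- The eigenvalues listed in decreasing order: index `0` gives the largest one, index `1` the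
second largest one, and so on (`Tuple.sort` sorts increasingly). -/
def decreasing {N : ℕ} (x : Fin N → ℝ) (k : Fin N) : ℝ := x (Tuple.sort x k.rev)

/-- The unordered point configuration of a spectrum, as a counting measure on `ℝ`. -/
def config {N : ℕ} (x : Fin N → ℝ) : Measure ℝ := ∑ i, Measure.dirac (x i)

/-- The configuration of the 2nd largest, 4th largest, … eigenvalues
(odd indices, as indices start from `0`). -/
def evenConfig {N : ℕ} (x : Fin N → ℝ) : Measure ℝ :=
  ∑ k : Fin N with k.val % 2 = 1, Measure.dirac (decreasing x k)

/-- The configuration of the largest, 3rd largest, … eigenvalues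
(even indices, as indices start from `0`). -/
def oddConfig {N : ℕ} (x : Fin N → ℝ) : Measure ℝ :=
  ∑ k : Fin N with k.val % 2 = 0, Measure.dirac (decreasing x k)

theorem measurable_decreasing {N : ℕ} (k : Fin N) :
    Measurable (fun x : Fin N → ℝ => decreasing x k) := by
  have key : ∀ σ : Equiv.Perm (Fin N), MeasurableSet {x : Fin N → ℝ | Tuple.sort x = σ} := by
    intro σ
    have h : {x : Fin N → ℝ | Tuple.sort x = σ} =
        (⋂ i, ⋂ j, {x : Fin N → ℝ | i ≤ j → x (σ i) ≤ x (σ j)}) ∩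
        (⋂ i, ⋂ j, {x : Fin N → ℝ | i < j → x (σ i) = x (σ j) → σ i < σ j}) := by
      ext x
      simp only [Set.mem_ofPred_eq, Set.mem_inter_iff, Set.mem_iInter]
      rw [eq_comm, Tuple.eq_sort_iff]
      rfl
    rw [h]
    refine MeasurableSet.inter ?_ ?_
    · refine MeasurableSet.iInter fun i => MeasurableSet.iInter fun j => ?_
      by_cases hij : i ≤ j
      · simp only [hij, true_imp_iff]
        exact measurableSet_le (measurable_pi_apply _) (measurable_pi_apply _)
      · simp [hij]
    · refine MeasurableSet.iInter fun i => MeasurableSet.iInter fun j => ?_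
      by_cases hij : i < j
      · by_cases hs : σ i < σ j
        · simp [hs]
        · simp only [hij, hs, true_imp_iff, imp_false]
          exact (measurableSet_eq_fun (measurable_pi_apply (σ i)) (measurable_pi_apply (σ j))).compl
      · simp [hij]
  intro t ht
  have h : (fun x : Fin N → ℝ => decreasing x k) ⁻¹' t =
      ⋃ σ : Equiv.Perm (Fin N), {x : Fin N → ℝ | Tuple.sort x = σ} ∩
        {x : Fin N → ℝ | x (σ k.rev) ∈ t} := by
    ext x
    simp [decreasing]
  rw [h]
  exact MeasurableSet.iUnion fun σ => (key σ).inter (measurable_pi_apply _ ht)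

theorem measurable_config {N : ℕ} : Measurable (config : (Fin N → ℝ) → Measure ℝ) := by
  unfold config
  have h : ∀ i ∈ (Finset.univ : Finset (Fin N)),
      Measurable (fun x : Fin N → ℝ => Measure.dirac (x i)) := fun i _ =>
    Measure.measurable_dirac.comp (measurable_pi_apply i)
  exact Finset.measurable_fun_sum _ h

theorem measurable_evenConfig {N : ℕ} : Measurable (evenConfig : (Fin N → ℝ) → Measure ℝ) := by
  unfold evenConfig
  exact Finset.measurable_fun_sum _ fun i _ =>
    Measure.measurable_dirac.comp (measurable_decreasing i)

theorem measurable_oddConfig {N : ℕ} : Measurable (oddConfig : (Fin N → ℝ) → Measure ℝ) := by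
  unfold oddConfig
  exact Finset.measurable_fun_sum _ fun i _ =>
    Measure.measurable_dirac.comp (measurable_decreasing i)

/-- The law of the unordered point configuration of an ensemble. -/
def law {N : ℕ} (M : Measure (Fin N → ℝ)) : Measure (Measure ℝ) := M.map config

/-- `even(M)`: the law of the configuration of the 2nd largest, 4th largest, … eigenvalues. -/
def even {N : ℕ} (M : Measure (Fin N → ℝ)) : Measure (Measure ℝ) := M.map evenConfig

/-- `odd(M)`: the law of the configuration of the largest, 3rd largest, … eigenvalues. -/
def odd {N : ℕ} (M : Measure (Fin N → ℝ)) : Measure (Measure ℝ) := M.map oddConfig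

/-- `alt(M)`, for an even number of eigenvalues: `even(M)` or `odd(M)`, each with
probability `1/2`. -/
def alt {N : ℕ} (M : Measure (Fin N → ℝ)) : Measure (Measure ℝ) :=
  (2⁻¹ : ℝ≥0∞) • even M + (2⁻¹ : ℝ≥0∞) • odd M

/-- `E^{(β)}(p; J; w; n)`: the probability that exactly `p` of the `n` eigenvalues lie in `J`.
It is `0` for negative `p`. -/
def gapProb (β : ℕ) (p : ℤ) (J : Set ℝ) (w : ℝ → ℝ) (n : ℕ) : ℝ :=
  (ensemble β w n).real {x | (Set.ncard {i | x i ∈ J} : ℤ) = p}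

end

end EigenvalueEnsemble

open EigenvalueEnsemble

/-!
Only the number `m` of eigenvalues in a half-line `J` matters. In the decreasing listing of `N`
eigenvalues, those in `(s, ∞)` occupy the indices `k < m` and those in `(-∞, -s)` the indices
`k ≥ N - m`. Counting the indices of a given parity in such a segment shows that the decimated
configuration has `⌊m / 2⌋` or `⌈m / 2⌉` points in `J`, the choice depending on the decimation, on
the half-line and on the parity of `N` (`evenConfig_Ioi`, `oddConfig_Ioi`, `evenConfig_Iio_of_odd`
and so on). So the decimated configuration has exactly `p` points in `J` if and only if `m` is one
of `2 * p`, `2 * p + 1`, respectively one of `2 * p`, `2 * p - 1` (`map_real_countEvent_floor`,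
`map_real_countEvent_ceil`).

An equality of laws of configurations transports the probability of having exactly `p` points in
`J`, an event measurable in the configuration (`measurableSet_countEvent`). This gives the
symplectic identities at once. For the unitary ones `p = 0`, so `m ≤ 1`, and the probability that
a superposition has no point or one point in `J` is a convolution of the probabilities of the two
independent spectra (`countProb_union_zero`, `countProb_union_one`).
-/

namespace EigenvalueEnsemble

noncomputable section

/-! ### Counting points in a set -/

/-- The number of entries of the spectrum `x` that lie in `J`. -/
def count {N : ℕ} (J : Set ℝ) (x : Fin N → ℝ) : ℕ := Set.ncard {i | x i ∈ J}

/-- The probability under `M` that exactly `p` entries of the spectrum lie in `J`. -/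
def countProb {N : ℕ} (M : Measure (Fin N → ℝ)) (J : Set ℝ) (p : ℤ) : ℝ :=
  M.real {x | (count J x : ℤ) = p}

/-- The configurations with exactly `p` points in `J`; there are none if `p` is negative. -/
def countEvent (J : Set ℝ) (p : ℤ) : Set (Measure ℝ) :=
  {μ | ∃ k : ℕ, (k : ℤ) = p ∧ μ J = k}

theorem gapProb_eq_countProb (β : ℕ) (p : ℤ) (J : Set ℝ) (w : ℝ → ℝ) (n : ℕ) :
    gapProb β p J w n = countProb (ensemble β w n) J p := rfl

theorem measurableSet_countEvent {J : Set ℝ} (hJ : MeasurableSet J) (p : ℤ) :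
    MeasurableSet (countEvent J p) := by
  have h : countEvent J p = ⋃ k : ℕ, {μ : Measure ℝ | (k : ℤ) = p ∧ μ J = k} := by
    ext μ
    simp [countEvent]
  rw [h]
  refine MeasurableSet.iUnion fun k => ?_
  by_cases hk : (k : ℤ) = p
  · simp only [hk, true_and]
    exact Measure.measurable_coe hJ (measurableSet_singleton (k : ℝ≥0∞))
  · simp [hk]

theorem mem_countEvent_of_apply_eq {J : Set ℝ} {p : ℤ} {μ : Measure ℝ} {m : ℕ}
    (h : μ J = m) : μ ∈ countEvent J p ↔ (m : ℤ) = p := by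
  simp [countEvent, h, eq_comm]

theorem count_eq_card {N : ℕ} (J : Set ℝ) (x : Fin N → ℝ) [DecidablePred (· ∈ J)] :
    count J x = (Finset.univ.filter fun i => x i ∈ J).card := by
  rw [count, ← Set.ncard_coe_finset]
  simp

theorem count_le {N : ℕ} (J : Set ℝ) (x : Fin N → ℝ) : count J x ≤ N := by
  classical
  rw [count_eq_card]
  exact (Finset.card_filter_le _ _).trans (by simp)

theorem sum_dirac_apply {ι : Type*} (S : Finset ι) (y : ι → ℝ) {J : Set ℝ}
    (hJ : MeasurableSet J) [DecidablePred (· ∈ J)] :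
    (∑ i ∈ S, Measure.dirac (y i)) J = ((S.filter fun i => y i ∈ J).card : ℝ≥0∞) := by
  rw [Measure.finsetSum_apply, Finset.card_filter, Nat.cast_sum]
  refine Finset.sum_congr rfl fun i _ => ?_
  rw [Measure.dirac_apply' _ hJ]
  by_cases h : y i ∈ J <;> simp [h]

theorem config_apply {N : ℕ} (x : Fin N → ℝ) {J : Set ℝ} (hJ : MeasurableSet J) :
    config x J = count J x := by
  classical
  rw [config, sum_dirac_apply _ _ hJ, count_eq_card]

theorem measurableSet_count_eq {N : ℕ} {J : Set ℝ} (hJ : MeasurableSet J) (p : ℤ) :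
    MeasurableSet {x : Fin N → ℝ | (count J x : ℤ) = p} := by
  convert measurable_config (N := N) (measurableSet_countEvent hJ p) using 1
  ext x
  exact (mem_countEvent_of_apply_eq (config_apply x hJ)).symm

theorem law_real_countEvent {N : ℕ} (M : Measure (Fin N → ℝ)) {J : Set ℝ}
    (hJ : MeasurableSet J) (p : ℤ) : (law M).real (countEvent J p) = countProb M J p := by
  rw [law, map_measureReal_apply measurable_config (measurableSet_countEvent hJ p), countProb]
  congr 1
  ext x
  exact mem_countEvent_of_apply_eq (config_apply x hJ)

theorem countProb_of_neg {N : ℕ} (M : Measure (Fin N → ℝ)) (J : Set ℝ) {p : ℤ} (hp : p < 0) :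
    countProb M J p = 0 := by
  have h : {x : Fin N → ℝ | (count J x : ℤ) = p} = ∅ := by
    ext x
    simp only [Set.mem_ofPred_eq, Set.mem_empty_iff_false, iff_false]
    omega
  rw [countProb, h, measureReal_empty]

theorem measureReal_count_eq_or {N : ℕ} (M : Measure (Fin N → ℝ)) [IsFiniteMeasure M]
    {J : Set ℝ} (hJ : MeasurableSet J) {p q : ℤ} (hpq : p ≠ q) :
    M.real {x | (count J x : ℤ) = p ∨ (count J x : ℤ) = q} =
      countProb M J p + countProb M J q := by
  rw [countProb, countProb, ← measureReal_union _ (measurableSet_count_eq hJ q)]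
  · rfl
  · exact Set.disjoint_left.2 fun x hx hx' => hpq (hx.symm.trans hx')

/-- If `c` keeps `⌊m / 2⌋` of the `m` points in `J`, then exactly `p` are kept if and only if
`m = 2 * p` or `m = 2 * p + 1`. -/
theorem map_real_countEvent_floor {N : ℕ} (M : Measure (Fin N → ℝ)) [IsFiniteMeasure M]
    {c : (Fin N → ℝ) → Measure ℝ} (hc : Measurable c) {J : Set ℝ} (hJ : MeasurableSet J)
    (h : ∀ x, c x J = (count J x / 2 : ℕ)) (p : ℤ) :
    (M.map c).real (countEvent J p) = countProb M J (2 * p) + countProb M J (2 * p + 1) := by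
  rw [map_measureReal_apply hc (measurableSet_countEvent hJ p),
    ← measureReal_count_eq_or M hJ (by omega)]
  congr 1
  ext x
  refine (mem_countEvent_of_apply_eq (h x)).trans ?_
  simp only [Set.mem_ofPred_eq]
  omega

/-- If `c` keeps `⌈m / 2⌉` of the `m` points in `J`, then exactly `p` are kept if and only if
`m = 2 * p` or `m = 2 * p - 1`. -/
theorem map_real_countEvent_ceil {N : ℕ} (M : Measure (Fin N → ℝ)) [IsFiniteMeasure M]
    {c : (Fin N → ℝ) → Measure ℝ} (hc : Measurable c) {J : Set ℝ} (hJ : MeasurableSet J)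
    (h : ∀ x, c x J = ((count J x + 1) / 2 : ℕ)) (p : ℤ) :
    (M.map c).real (countEvent J p) = countProb M J (2 * p) + countProb M J (2 * p - 1) := by
  rw [map_measureReal_apply hc (measurableSet_countEvent hJ p),
    ← measureReal_count_eq_or M hJ (by omega)]
  congr 1
  ext x
  refine (mem_countEvent_of_apply_eq (h x)).trans ?_
  simp only [Set.mem_ofPred_eq]
  omega

/-! ### Half-lines and the decreasing listing -/

theorem antitone_decreasing {N : ℕ} (x : Fin N → ℝ) : Antitone (decreasing x) := fun _ _ h =>
  Tuple.monotone_sort x (Fin.rev_le_rev.2 h)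

theorem count_decreasing {N : ℕ} (J : Set ℝ) (x : Fin N → ℝ) :
    count J (decreasing x) = count J x := by
  have h : {i | x i ∈ J} =
      (Fin.revPerm.trans (Tuple.sort x)) '' {k | decreasing x k ∈ J} := by
    ext i
    rw [Equiv.image_eq_preimage_symm]
    simp [decreasing]
  rw [count, count, h, Set.ncard_image_of_injective _ (Equiv.injective _)]

theorem mem_iff_lt_card_of_isLowerSet {N : ℕ} {A : Finset (Fin N)}
    (hA : IsLowerSet (A : Set (Fin N))) (k : Fin N) : k ∈ A ↔ k.val < A.card := by
  constructor
  · intro hk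
    have h : Finset.Iic k ⊆ A := fun j hj => hA (Finset.mem_Iic.1 hj) hk
    have := Finset.card_le_card h
    rw [Fin.card_Iic] at this
    omega
  · intro hk
    by_contra hkA
    have h : A ⊆ Finset.Iio k := fun j hj =>
      Finset.mem_Iio.2 (lt_of_not_ge fun hkj => hkA (hA hkj hj))
    have := Finset.card_le_card h
    rw [Fin.card_Iio] at this
    omega

theorem decreasing_mem_Ioi_iff {N : ℕ} (x : Fin N → ℝ) (s : ℝ) (k : Fin N) :
    decreasing x k ∈ Set.Ioi s ↔ k.val < count (Set.Ioi s) x := by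
  classical
  rw [← count_decreasing, count_eq_card, ← mem_iff_lt_card_of_isLowerSet]
  · simp
  · intro a b hba ha
    simp only [Finset.coe_filter, Finset.mem_univ, true_and, Set.mem_ofPred_eq, Set.mem_Ioi]
      at ha ⊢
    exact ha.trans_le (antitone_decreasing x hba)

theorem decreasing_mem_Iio_iff {N : ℕ} (x : Fin N → ℝ) (s : ℝ) (k : Fin N) :
    decreasing x k ∈ Set.Iio s ↔ ¬ k.val < N - count (Set.Iio s) x := by
  classical
  have hcard := Finset.card_filter_add_card_filter_not (s := (Finset.univ : Finset (Fin N)))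
    (fun k => decreasing x k ∈ Set.Iio s)
  have hcount := count_eq_card (Set.Iio s) (decreasing x)
  rw [count_decreasing] at hcount
  rw [Finset.card_univ, Fintype.card_fin] at hcard
  have hsub : N - count (Set.Iio s) x =
      (Finset.univ.filter fun k => ¬ decreasing x k ∈ Set.Iio s).card := by omega
  rw [hsub, ← mem_iff_lt_card_of_isLowerSet]
  · simp
  · intro a b hba ha
    simp only [Finset.coe_filter, Finset.mem_univ, true_and, Set.mem_ofPred_eq, Set.mem_Iio,
      not_lt] at ha ⊢
    exact ha.trans (antitone_decreasing x hba)

/-! ### Decimated configurations on half-lines -/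

theorem card_fin_filter_lt {N m : ℕ} (hm : m ≤ N) (P : ℕ → Prop) [DecidablePred P] :
    (Finset.univ.filter fun k : Fin N => P k.val ∧ k.val < m).card =
      ((Finset.range m).filter P).card := by
  refine Finset.card_bij (fun k _ => k.val) ?_ (fun _ _ _ _ => Fin.ext) ?_
  · intro k hk
    simpa [and_comm] using hk
  · intro b hb
    simp only [Finset.mem_filter, Finset.mem_range] at hb
    exact ⟨⟨b, by omega⟩, by simpa [and_comm] using hb, rfl⟩

theorem card_range_odd (m : ℕ) : ((Finset.range m).filter fun k => k % 2 = 1).card = m / 2 := by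
  induction m with
  | zero => rfl
  | succ m ih =>
    rw [Finset.range_add_one, Finset.filter_insert]
    split_ifs
    · rw [Finset.card_insert_of_notMem (by simp), ih]
      omega
    · rw [ih]
      omega

theorem card_range_even (m : ℕ) :
    ((Finset.range m).filter fun k => k % 2 = 0).card = (m + 1) / 2 := by
  induction m with
  | zero => rfl
  | succ m ih =>
    rw [Finset.range_add_one, Finset.filter_insert]
    split_ifs
    · rw [Finset.card_insert_of_notMem (by simp), ih]
      omega
    · rw [ih]
      omega

theorem card_fin_filter_not_lt {N m : ℕ} (hm : m ≤ N) (P : ℕ → Prop) [DecidablePred P] :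
    (Finset.univ.filter fun k : Fin N => P k.val ∧ ¬ k.val < m).card =
      ((Finset.range N).filter P).card - ((Finset.range m).filter P).card := by
  have h := Finset.card_filter_add_card_filter_not
    (s := Finset.univ.filter fun k : Fin N => P k.val) (fun k => k.val < m)
  rw [Finset.filter_filter, Finset.filter_filter, card_fin_filter_lt hm] at h
  have hN := card_fin_filter_lt (le_refl N) P
  simp only [Fin.is_lt, and_true] at hN
  omega

theorem evenConfig_Ioi {N : ℕ} (x : Fin N → ℝ) (s : ℝ) :
    evenConfig x (Set.Ioi s) = (count (Set.Ioi s) x / 2 : ℕ) := by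
  classical
  rw [evenConfig, sum_dirac_apply _ _ measurableSet_Ioi, Finset.filter_filter]
  simp only [decreasing_mem_Ioi_iff]
  rw [card_fin_filter_lt (count_le _ x) (fun k => k % 2 = 1), card_range_odd]

theorem oddConfig_Ioi {N : ℕ} (x : Fin N → ℝ) (s : ℝ) :
    oddConfig x (Set.Ioi s) = ((count (Set.Ioi s) x + 1) / 2 : ℕ) := by
  classical
  rw [oddConfig, sum_dirac_apply _ _ measurableSet_Ioi, Finset.filter_filter]
  simp only [decreasing_mem_Ioi_iff]
  rw [card_fin_filter_lt (count_le _ x) (fun k => k % 2 = 0), card_range_even]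

theorem evenConfig_Iio {N : ℕ} (x : Fin N → ℝ) (s : ℝ) :
    evenConfig x (Set.Iio s) = (N / 2 - (N - count (Set.Iio s) x) / 2 : ℕ) := by
  classical
  rw [evenConfig, sum_dirac_apply _ _ measurableSet_Iio, Finset.filter_filter]
  simp only [decreasing_mem_Iio_iff]
  rw [card_fin_filter_not_lt (Nat.sub_le _ _) (fun k => k % 2 = 1), card_range_odd,
    card_range_odd]

theorem oddConfig_Iio {N : ℕ} (x : Fin N → ℝ) (s : ℝ) :
    oddConfig x (Set.Iio s) = ((N + 1) / 2 - (N - count (Set.Iio s) x + 1) / 2 : ℕ) := by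
  classical
  rw [oddConfig, sum_dirac_apply _ _ measurableSet_Iio, Finset.filter_filter]
  simp only [decreasing_mem_Iio_iff]
  rw [card_fin_filter_not_lt (Nat.sub_le _ _) (fun k => k % 2 = 0), card_range_even,
    card_range_even]

theorem evenConfig_Iio_of_odd {N : ℕ} (hN : Odd N) (x : Fin N → ℝ) (s : ℝ) :
    evenConfig x (Set.Iio s) = (count (Set.Iio s) x / 2 : ℕ) := by
  rw [evenConfig_Iio]
  have h := count_le (Set.Iio s) x
  have h2 := Nat.odd_iff.1 hN
  congr 1
  omega

theorem evenConfig_Iio_of_even {N : ℕ} (hN : Even N) (x : Fin N → ℝ) (s : ℝ) :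
    evenConfig x (Set.Iio s) = ((count (Set.Iio s) x + 1) / 2 : ℕ) := by
  rw [evenConfig_Iio]
  have h := count_le (Set.Iio s) x
  have h2 := Nat.even_iff.1 hN
  congr 1
  omega

theorem oddConfig_Iio_of_odd {N : ℕ} (hN : Odd N) (x : Fin N → ℝ) (s : ℝ) :
    oddConfig x (Set.Iio s) = ((count (Set.Iio s) x + 1) / 2 : ℕ) := by
  rw [oddConfig_Iio]
  have h := count_le (Set.Iio s) x
  have h2 := Nat.odd_iff.1 hN
  congr 1
  omega

theorem oddConfig_Iio_of_even {N : ℕ} (hN : Even N) (x : Fin N → ℝ) (s : ℝ) :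
    oddConfig x (Set.Iio s) = (count (Set.Iio s) x / 2 : ℕ) := by
  rw [oddConfig_Iio]
  have h := count_le (Set.Iio s) x
  have h2 := Nat.even_iff.1 hN
  congr 1
  omega

/-! ### Gap probabilities of decimated ensembles -/

section Decimation

variable {N : ℕ} (M : Measure (Fin N → ℝ)) [IsFiniteMeasure M] (s : ℝ) (p : ℤ)

theorem even_real_Ioi : (even M).real (countEvent (Set.Ioi s) p) =
    countProb M (Set.Ioi s) (2 * p) + countProb M (Set.Ioi s) (2 * p + 1) :=
  map_real_countEvent_floor M measurable_evenConfig measurableSet_Ioi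
    (fun x => evenConfig_Ioi x s) p

theorem odd_real_Ioi : (odd M).real (countEvent (Set.Ioi s) p) =
    countProb M (Set.Ioi s) (2 * p) + countProb M (Set.Ioi s) (2 * p - 1) :=
  map_real_countEvent_ceil M measurable_oddConfig measurableSet_Ioi
    (fun x => oddConfig_Ioi x s) p

theorem even_real_Iio_of_even (hN : Even N) : (even M).real (countEvent (Set.Iio s) p) =
    countProb M (Set.Iio s) (2 * p) + countProb M (Set.Iio s) (2 * p - 1) :=
  map_real_countEvent_ceil M measurable_evenConfig measurableSet_Iio
    (fun x => evenConfig_Iio_of_even hN x s) p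

theorem odd_real_Iio_of_even (hN : Even N) : (odd M).real (countEvent (Set.Iio s) p) =
    countProb M (Set.Iio s) (2 * p) + countProb M (Set.Iio s) (2 * p + 1) :=
  map_real_countEvent_floor M measurable_oddConfig measurableSet_Iio
    (fun x => oddConfig_Iio_of_even hN x s) p

theorem even_real_of_odd (hN : Odd N) {J : Set ℝ} (hJ : J = Set.Iio (-s) ∨ J = Set.Ioi s) :
    (even M).real (countEvent J p) = countProb M J (2 * p) + countProb M J (2 * p + 1) := by
  rcases hJ with rfl | rfl
  · exact map_real_countEvent_floor M measurable_evenConfig measurableSet_Iio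
      (fun x => evenConfig_Iio_of_odd hN x (-s)) p
  · exact even_real_Ioi M s p

theorem odd_real_of_odd (hN : Odd N) {J : Set ℝ} (hJ : J = Set.Iio (-s) ∨ J = Set.Ioi s) :
    (odd M).real (countEvent J p) = countProb M J (2 * p) + countProb M J (2 * p - 1) := by
  rcases hJ with rfl | rfl
  · exact map_real_countEvent_ceil M measurable_oddConfig measurableSet_Iio
      (fun x => oddConfig_Iio_of_odd hN x (-s)) p
  · exact odd_real_Ioi M s p

theorem alt_real_eq (S : Set (Measure ℝ)) :
    (alt M).real S = 1 / 2 * (even M).real S + 1 / 2 * (odd M).real S := by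
  have : IsFiniteMeasure (even M) := by unfold even; infer_instance
  have : IsFiniteMeasure (odd M) := by unfold odd; infer_instance
  simp only [alt, measureReal_def, Measure.add_apply, Measure.smul_apply, smul_eq_mul]
  rw [ENNReal.toReal_add (ENNReal.mul_ne_top (by simp) (measure_ne_top _ _))
    (ENNReal.mul_ne_top (by simp) (measure_ne_top _ _))]
  simp

/-- For an even number of eigenvalues, one of the two decimations sees `⌊m / 2⌋` points in `J` and
the other `⌈m / 2⌉`, whichever half-line `J` is. -/
theorem alt_real_of_even (hN : Even N) {J : Set ℝ} (hJ : J = Set.Iio (-s) ∨ J = Set.Ioi s) :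
    (alt M).real (countEvent J p) = countProb M J (2 * p)
      + 1 / 2 * countProb M J (2 * p - 1) + 1 / 2 * countProb M J (2 * p + 1) := by
  rw [alt_real_eq]
  rcases hJ with rfl | rfl
  · rw [even_real_Iio_of_even M _ p hN, odd_real_Iio_of_even M _ p hN]
    ring
  · rw [even_real_Ioi, odd_real_Ioi]
    ring

end Decimation

/-! ### Superpositions -/

theorem isProbabilityMeasure_ensemble {β : ℕ} {w : ℝ → ℝ} {n : ℕ} (h : IsNormalizable β w n) :
    IsProbabilityMeasure (ensemble β w n) := by
  refine ⟨?_⟩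
  rw [ensemble, Measure.smul_apply, withDensity_apply _ MeasurableSet.univ, setLIntegral_univ,
    smul_eq_mul]
  exact ENNReal.inv_mul_cancel h.1.ne' h.2.ne

theorem count_append {m n : ℕ} (J : Set ℝ) (x : Fin m → ℝ) (y : Fin n → ℝ) :
    count J (Fin.append x y) = count J x + count J y := by
  classical
  simp only [count_eq_card, Finset.card_filter, Fin.sum_univ_add, Fin.append_left,
    Fin.append_right]

theorem measurable_append {m n : ℕ} :
    Measurable (fun q : (Fin m → ℝ) × (Fin n → ℝ) => Fin.append q.1 q.2) := by
  refine measurable_pi_iff.2 fun i => ?_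
  refine Fin.addCases (fun i => ?_) (fun i => ?_) i
  · simp only [Fin.append_left]
    exact (measurable_pi_apply i).comp measurable_fst
  · simp only [Fin.append_right]
    exact (measurable_pi_apply i).comp measurable_snd

section Union

variable {m n : ℕ} (M : Measure (Fin m → ℝ)) (M' : Measure (Fin n → ℝ))

instance [IsFiniteMeasure M] [IsFiniteMeasure M'] : IsFiniteMeasure (union M M') := by
  unfold union
  infer_instance

theorem countProb_union {J : Set ℝ} (hJ : MeasurableSet J) (p : ℤ) : countProb (union M M') J p =
    (M.prod M').real {q | (count J q.1 + count J q.2 : ℤ) = p} := by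
  rw [countProb, union, map_measureReal_apply measurable_append (measurableSet_count_eq hJ p)]
  simp [Set.preimage, count_append]

theorem countProb_union_zero [SFinite M'] {J : Set ℝ} (hJ : MeasurableSet J) :
    countProb (union M M') J 0 = countProb M J 0 * countProb M' J 0 := by
  rw [countProb_union M M' hJ, countProb, countProb, ← measureReal_prod_prod]
  congr 1
  ext q
  simp only [Set.mem_ofPred_eq, Set.mem_prod]
  omega

theorem countProb_union_one [IsFiniteMeasure M] [IsFiniteMeasure M'] {J : Set ℝ}
    (hJ : MeasurableSet J) :
    countProb (union M M') J 1 =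
      countProb M J 0 * countProb M' J 1 + countProb M J 1 * countProb M' J 0 := by
  rw [countProb_union M M' hJ]
  simp only [countProb]
  rw [← measureReal_prod_prod, ← measureReal_prod_prod,
    ← measureReal_union _ ((measurableSet_count_eq hJ 1).prod (measurableSet_count_eq hJ 0))]
  · congr 1
    ext q
    simp only [Set.mem_ofPred_eq, Set.mem_union, Set.mem_prod]
    omega
  · refine Set.disjoint_left.2 fun q hq hq' => ?_
    simp only [Set.mem_ofPred_eq, Set.mem_prod] at hq hq'
    omega

end Union

theorem measurableSet_of_halfLine {s : ℝ} {J : Set ℝ} (hJ : J = Set.Iio (-s) ∨ J = Set.Ioi s) :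
    MeasurableSet J := by
  rcases hJ with rfl | rfl
  · exact measurableSet_Iio
  · exact measurableSet_Ioi

end

end EigenvalueEnsemble

open EigenvalueEnsemble
/-! ### Relations between gap probabilities -/

theorem mainTheorem9 (n : ℕ) (hn : 1 ≤ n) (f g : ℝ → ℝ)
    (hf_meas : Measurable f) (hf_nonneg : ∀ x, 0 ≤ f x)
    (hg_meas : Measurable g) (hg_nonneg : ∀ x, 0 ≤ g x) :
    -- even, `2n` and `2n + 1` eigenvalues
    (IsNormalizable 1 f (2 * n) → IsNormalizable 1 f (2 * n + 1) →
      even (union (OE (2 * n) f) (OE (2 * n + 1) f)) = law (UE (2 * n) g) →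
      ∀ s : ℝ, ∀ J : Set ℝ, (J = Set.Iio (-s) ∨ J = Set.Ioi s) →
        gapProb 2 0 J g (2 * n) =
          gapProb 1 0 J f (2 * n) * gapProb 1 0 J f (2 * n + 1)
          + gapProb 1 0 J f (2 * n) * gapProb 1 1 J f (2 * n + 1)
          + gapProb 1 0 J f (2 * n + 1) * gapProb 1 1 J f (2 * n)) ∧
    (IsNormalizable 1 f (2 * n + 1) →
      even (OE (2 * n + 1) f) = law (SE n (fun x => (g x / f x) ^ 2)) →
      ∀ s : ℝ, ∀ J : Set ℝ, (J = Set.Iio (-s) ∨ J = Set.Ioi s) → ∀ p : ℤ,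
        gapProb 4 p J (fun x => (g x / f x) ^ 2) n =
          gapProb 1 (2 * p) J f (2 * n + 1) + gapProb 1 (2 * p + 1) J f (2 * n + 1)) ∧
    -- even, `2n` eigenvalues
    (IsNormalizable 1 f (2 * n) →
      even (union (OE (2 * n) f) (OE (2 * n) f)) = law (UE (2 * n) g) →
      ∀ s : ℝ,
        gapProb 2 0 (Set.Ioi s) g (2 * n) =
          gapProb 1 0 (Set.Ioi s) f (2 * n) ^ 2
          + 2 * gapProb 1 0 (Set.Ioi s) f (2 * n) * gapProb 1 1 (Set.Ioi s) f (2 * n) ∧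
        gapProb 2 0 (Set.Iio (-s)) g (2 * n) = gapProb 1 0 (Set.Iio (-s)) f (2 * n) ^ 2) ∧
    (IsNormalizable 1 f (2 * n) →
      even (OE (2 * n) f) = law (SE n (fun x => (g x / f x) ^ 2)) →
      ∀ s : ℝ, ∀ p : ℤ,
        gapProb 4 p (Set.Ioi s) (fun x => (g x / f x) ^ 2) n =
          gapProb 1 (2 * p) (Set.Ioi s) f (2 * n)
          + gapProb 1 (2 * p + 1) (Set.Ioi s) f (2 * n) ∧
        gapProb 4 p (Set.Iio (-s)) (fun x => (g x / f x) ^ 2) n =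
          gapProb 1 (2 * p) (Set.Iio (-s)) f (2 * n)
          + gapProb 1 (2 * p - 1) (Set.Iio (-s)) f (2 * n)) ∧
    -- odd, `2n` eigenvalues
    (IsNormalizable 1 f (2 * n) →
      odd (union (OE (2 * n) f) (OE (2 * n) f)) = law (UE (2 * n) g) →
      ∀ s : ℝ,
        gapProb 2 0 (Set.Ioi s) g (2 * n) = gapProb 1 0 (Set.Ioi s) f (2 * n) ^ 2 ∧
        gapProb 2 0 (Set.Iio (-s)) g (2 * n) =
          gapProb 1 0 (Set.Iio (-s)) f (2 * n) ^ 2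
          + 2 * gapProb 1 0 (Set.Iio (-s)) f (2 * n)
            * gapProb 1 1 (Set.Iio (-s)) f (2 * n)) ∧
    (IsNormalizable 1 f (2 * n) →
      odd (OE (2 * n) f) = law (SE n (fun x => (g x / f x) ^ 2)) →
      ∀ s : ℝ, ∀ p : ℤ,
        gapProb 4 p (Set.Ioi s) (fun x => (g x / f x) ^ 2) n =
          gapProb 1 (2 * p) (Set.Ioi s) f (2 * n)
          + gapProb 1 (2 * p - 1) (Set.Ioi s) f (2 * n) ∧
        gapProb 4 p (Set.Iio (-s)) (fun x => (g x / f x) ^ 2) n =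
          gapProb 1 (2 * p) (Set.Iio (-s)) f (2 * n)
          + gapProb 1 (2 * p + 1) (Set.Iio (-s)) f (2 * n)) ∧
    -- odd, `2n - 1` and `2n` eigenvalues
    (IsNormalizable 1 f (2 * n - 1) → IsNormalizable 1 f (2 * n) →
      odd (union (OE (2 * n - 1) f) (OE (2 * n) f)) = law (UE (2 * n) g) →
      ∀ s : ℝ, ∀ J : Set ℝ, (J = Set.Iio (-s) ∨ J = Set.Ioi s) →
        gapProb 2 0 J g (2 * n) = gapProb 1 0 J f (2 * n) * gapProb 1 0 J f (2 * n - 1)) ∧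
    (IsNormalizable 1 f (2 * n - 1) →
      odd (OE (2 * n - 1) f) = law (SE n (fun x => (g x / f x) ^ 2)) →
      ∀ s : ℝ, ∀ J : Set ℝ, (J = Set.Iio (-s) ∨ J = Set.Ioi s) → ∀ p : ℤ,
        gapProb 4 p J (fun x => (g x / f x) ^ 2) n =
          gapProb 1 (2 * p) J f (2 * n - 1) + gapProb 1 (2 * p - 1) J f (2 * n - 1)) ∧
    -- alt, `2n` eigenvalues
    (IsNormalizable 1 f (2 * n) →
      alt (union (OE (2 * n) f) (OE (2 * n) f)) = law (UE (2 * n) g) →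
      ∀ s : ℝ, ∀ J : Set ℝ, (J = Set.Iio (-s) ∨ J = Set.Ioi s) →
        gapProb 2 0 J g (2 * n) =
          gapProb 1 0 J f (2 * n) * (gapProb 1 0 J f (2 * n) + gapProb 1 1 J f (2 * n))) ∧
    (IsNormalizable 1 f (2 * n) →
      alt (OE (2 * n) f) = law (SE n (fun x => (g x / f x) ^ 2)) →
      ∀ s : ℝ, ∀ J : Set ℝ, (J = Set.Iio (-s) ∨ J = Set.Ioi s) → ∀ p : ℤ,
        gapProb 4 p J (fun x => (g x / f x) ^ 2) n =
          gapProb 1 (2 * p) J f (2 * n)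
          + 1 / 2 * gapProb 1 (2 * p - 1) J f (2 * n)
          + 1 / 2 * gapProb 1 (2 * p + 1) J f (2 * n)) := by
  simp only [gapProb_eq_countProb]
  refine ⟨?_, ?_, ?_, ?_, ?_, ?_, ?_, ?_, ?_, ?_⟩
  · intro h₁ h₂ h s J hJ
    have := isProbabilityMeasure_ensemble h₁
    have := isProbabilityMeasure_ensemble h₂
    have hJm := measurableSet_of_halfLine hJ
    rw [← law_real_countEvent _ hJm, ← h,
      even_real_of_odd _ s 0 ⟨2 * n, by omega⟩ hJ, mul_zero, zero_add,
      countProb_union_zero _ _ hJm, countProb_union_one _ _ hJm]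
    ring
  · intro h₁ h s J hJ p
    have := isProbabilityMeasure_ensemble h₁
    rw [← law_real_countEvent _ (measurableSet_of_halfLine hJ), ← h,
      even_real_of_odd _ s p ⟨n, rfl⟩ hJ]
  · intro h₁ h s
    have := isProbabilityMeasure_ensemble h₁
    constructor
    · rw [← law_real_countEvent _ measurableSet_Ioi, ← h, even_real_Ioi, mul_zero, zero_add,
        countProb_union_zero _ _ measurableSet_Ioi, countProb_union_one _ _ measurableSet_Ioi]
      ring
    · rw [← law_real_countEvent _ measurableSet_Iio, ← h, even_real_Iio_of_even _ _ _ ⟨_, rfl⟩,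
        countProb_of_neg _ _ (show (2 * 0 - 1 : ℤ) < 0 by norm_num), mul_zero,
        countProb_union_zero _ _ measurableSet_Iio]
      ring
  · intro h₁ h s p
    have := isProbabilityMeasure_ensemble h₁
    constructor
    · rw [← law_real_countEvent _ measurableSet_Ioi, ← h, even_real_Ioi]
    · rw [← law_real_countEvent _ measurableSet_Iio, ← h,
        even_real_Iio_of_even _ _ _ (even_two_mul n)]
  · intro h₁ h s
    have := isProbabilityMeasure_ensemble h₁
    constructor
    · rw [← law_real_countEvent _ measurableSet_Ioi, ← h, odd_real_Ioi,
        countProb_of_neg _ _ (show (2 * 0 - 1 : ℤ) < 0 by norm_num), mul_zero,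
        countProb_union_zero _ _ measurableSet_Ioi]
      ring
    · rw [← law_real_countEvent _ measurableSet_Iio, ← h, odd_real_Iio_of_even _ _ _ ⟨_, rfl⟩,
        mul_zero, zero_add, countProb_union_zero _ _ measurableSet_Iio,
        countProb_union_one _ _ measurableSet_Iio]
      ring
  · intro h₁ h s p
    have := isProbabilityMeasure_ensemble h₁
    constructor
    · rw [← law_real_countEvent _ measurableSet_Ioi, ← h, odd_real_Ioi]
    · rw [← law_real_countEvent _ measurableSet_Iio, ← h,
        odd_real_Iio_of_even _ _ _ (even_two_mul n)]
  · intro h₁ h₂ h s J hJ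
    have := isProbabilityMeasure_ensemble h₁
    have := isProbabilityMeasure_ensemble h₂
    have hJm := measurableSet_of_halfLine hJ
    rw [← law_real_countEvent _ hJm, ← h,
      odd_real_of_odd _ s 0 ⟨2 * n - 1, by omega⟩ hJ,
      countProb_of_neg _ _ (show (2 * 0 - 1 : ℤ) < 0 by norm_num), mul_zero,
      countProb_union_zero _ _ hJm]
    ring
  · intro h₁ h s J hJ p
    have := isProbabilityMeasure_ensemble h₁
    rw [← law_real_countEvent _ (measurableSet_of_halfLine hJ), ← h,
      odd_real_of_odd _ s p ⟨n - 1, by omega⟩ hJ]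
  · intro h₁ h s J hJ
    have := isProbabilityMeasure_ensemble h₁
    have hJm := measurableSet_of_halfLine hJ
    rw [← law_real_countEvent _ hJm, ← h, alt_real_of_even _ s 0 ⟨_, rfl⟩ hJ,
      countProb_of_neg _ _ (show (2 * 0 - 1 : ℤ) < 0 by norm_num), mul_zero, zero_add,
      countProb_union_zero _ _ hJm, countProb_union_one _ _ hJm]
    ring
  · intro h₁ h s J hJ p
    have := isProbabilityMeasure_ensemble h₁
    rw [← law_real_countEvent _ (measurableSet_of_halfLine hJ), ← h,
      alt_real_of_even _ s p (even_two_mul n) hJ]
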